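/- Let $N$ agents $\mathcal N=\{1,\dots,N\}$ have closed convex nonempty sets $\mathcal X_i\subseteq\mathbb R^{n_i}$, matrices $A_i\in\mathbb R^{l\times n_i}$ and jointly closed convex proper functions $J_i:\mathcal X_i\times\mathbb R^l\to\mathbb R\cup\{+\infty\}$, and let $c\in\mathbb R^l$. Put $s_i(x_{-i})=\sum_{j\ne i}A_jx_j$ and consider $$\text{minimize } J(x)=\sum_{i}J_i(x_i,s_i(x_{-i}))\quad\text{over } \tilde{\mathcal X}=\Big\{x\in\prod_i\mathcal X_i : \sum_iA_ix_i\le c\Big\};\tag{1}$$ a minimizer is a point $x\in\tilde{\mathcal X}$ with $J(x)<+\infty$ and $J(x)\le J(x')$ for all $x'\in\tilde{\mathcal X}$. Assume Slater's condition: some $x\in\prod_i\mathcal X_i$ satisfies $\sum_iA_ix_i<c$ componentwise. Let $\mathcal G=(\mathcal N,\mathcal E)$ be an undirected connected graph without self-loops in which every node has a neighbour; $\mathcal E$ is its set of directed edges, so $(i,j)\in\mathcal E$ if and only if $(j,i)\in\mathcal E$. Let $W\in\mathbb R^{N\times N}$ satisfy $W_{ij}<0$ if $(i,j)\in\mathcal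 E$, $W_{ij}=0$ if $j\ne i$ and $(i,j)\notin\mathcal E$, and $W_{ii}=-\sum_{j\neq i}W_{ij}$. The variables are $\psi=[x;\sigma;\lambda;\omega]$ with $\sigma=(\sigma_i)_{i\in\mathcal N}$, $\lambda=(\lambda_{ji})_{(j,i)\in\mathcal E}$ and $\omega$ consisting of $(y_i)_{i\in\mathcal N}$, $(\mu_{ji})_{(j,i)\in\mathcal E}$ and $(y_{ji})_{(j,i)\in\mathcal E}$, where all of $\sigma_i,\lambda_{ji},y_i,\mu_{ji},y_{ji}$ are in $\mathbb R^l$. Let $\mathcal Q_i=\{A_ix_i+\sigma_i\le c\}$, $\mathcal F_i=\{(N-1)A_ix_i-\sigma_i=W_{ii}y_i+\sum_{j:(j,i)\in\mathcal E}W_{ji}y_{ji}\}$, with $\iota$ denoting the $0/{+\infty}$ indicator function, and let $$\mathcal L_{\rm net}=\underbrace{\sum_i\big(J_i(x_i,\sigma_i)+\iota_{\mathcal X_i}+\iota_{\mathcal Q_i}+\iota_{\mathcal F_i}\big)}_{\Theta(\psi)}+\underbrace{\sum_{(j,i)\in\mathcal E}\big(\lambda_{ji}^T(A_ix_i+\sigma_i-A_jx_j-\sigma_j)+\mu_{ji}^T(y_{ji}-y_j)\big)}_{K(\psi)}.$$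 Let $T(\psi)=\partial\Theta(\psi)+D\psi$, where $\partial\Theta$ is the convex subdifferential (empty where $\Theta=+\infty$) and $D\psi$ is the gradient of $K$ with the sign of the components belonging to the dual variables $\lambda,\mu$ reversed. Then for every $[x^*;\sigma^*;\lambda^*;\omega^*]$ with $0\in T([x^*;\sigma^*;\lambda^*;\omega^*])$, the point $x^*$ is a minimizer of (1). Conversely, suppose in addition that there is $\hat x\in\tilde{\mathcal X}$ such that $(\hat x_i,s_i(\hat x_{-i}))$ lies in the relative interior of $\operatorname{dom}J_i=\{(x_i,s_i)\in\mathcal X_i\times\mathbb R^l: J_i(x_i,s_i)<+\infty\}$ for every $i$ (Slater's condition already implies this if all $J_i$ are finite on $\mathcal X_i\times\mathbb R^l$). Then for every minimizer $x^\dagger$ of (1) there are $\sigma^\dagger,\lambda^\dagger,\omega^\dagger$ with $0\in T([x^\dagger;\sigma^\dagger;\lambda^\dagger;\omega^\dagger])$. -/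

import Mathlib

open scoped Matrix

noncomputable section

/-- Effective domain, within `S`, of a function with values in `ℝ ∪ {+∞}`. -/
def effDomOn {V : Type*} (S : Set V) (f : V → WithTop ℝ) : Set V :=
  {p | p ∈ S ∧ f p < ⊤}

/-- Epigraph of the restriction of `f` to `S`. -/
def epigraphOn {V : Type*} (S : Set V) (f : V → WithTop ℝ) : Set (V × ℝ) :=
  {q | q.1 ∈ S ∧ f q.1 ≤ (q.2 : WithTop ℝ)}

/-- `f : S → ℝ ∪ {+∞}` is closed, convex and proper. Values of `f` outside `S` are irrelevant. -/
structure IsCCPOn {V : Type*} [AddCommGroup V] [Module ℝ V] [TopologicalSpace V]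
    (S : Set V) (f : V → WithTop ℝ) : Prop where
  closed : IsClosed (epigraphOn S f)
  convex : Convex ℝ (epigraphOn S f)
  proper : (effDomOn S f).Nonempty

open Classical in
/-- The indicator function of a set in the sense of convex analysis. -/
def convIndicator {V : Type*} (S : Set V) (p : V) : WithTop ℝ :=
  if p ∈ S then 0 else ⊤

/-- Data of the aggregatively coupled problem with `N` agents and `l` resources: dimensions `n i`,
objectives `J i (x_i, s_i)`, local sets `X i`, matrices `A i` and the resource vector `c`. -/
structure AggProblem (N l : ℕ) where
  n : Fin N → ℕ
  J : ∀ i, (Fin (n i) → ℝ) × (Fin l → ℝ) → WithTop ℝ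
  X : ∀ i, Set (Fin (n i) → ℝ)
  A : ∀ i, Matrix (Fin l) (Fin (n i)) ℝ
  c : Fin l → ℝ

namespace AggProblem

variable {N l : ℕ} (P : AggProblem N l)

/-- Joint decisions `x = [x_1; …; x_N]`. -/
abbrev Decision : Type := ∀ i, Fin (P.n i) → ℝ

/-- The domain `X_i × ℝ^l` of `J_i`. -/
def objDomain (i : Fin N) : Set ((Fin (P.n i) → ℝ) × (Fin l → ℝ)) :=
  P.X i ×ˢ Set.univ

/-- `s_i(x_{-i}) = ∑_{j ≠ i} A_j x_j`. -/
def aggregate (i : Fin N) (x : P.Decision) : Fin l → ℝ :=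
  ∑ j ∈ Finset.univ.erase i, P.A j *ᵥ x j

/-- `J(x) = ∑_i J_i(x_i, s_i(x_{-i}))`. -/
def objective (x : P.Decision) : WithTop ℝ :=
  ∑ i, P.J i (x i, P.aggregate i x)

/-- The globally constrained set `{x ∈ ∏ X_i | ∑_i A_i x_i ≤ c}`. -/
def feasible : Set P.Decision :=
  {x | (∀ i, x i ∈ P.X i) ∧ ∑ i, P.A i *ᵥ x i ≤ P.c}

/-- Slater's constraint qualification for the globally constrained set. -/
def Slater : Prop :=
  ∃ x : P.Decision, (∀ i, x i ∈ P.X i) ∧ ∀ k, (∑ i, P.A i *ᵥ x i) k < P.c k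

/-- Domain qualification: some feasible `x` has every `(x_i, s_i(x_{-i}))` in the relative interior
of the effective domain of `J_i`. -/
def DomainQualified : Prop :=
  ∃ x ∈ P.feasible, ∀ i,
    (x i, P.aggregate i x) ∈ intrinsicInterior ℝ (effDomOn (P.objDomain i) (P.J i))

/-- Minimizers of the original problem (with finite optimal value). -/
def IsMinimizer (x : P.Decision) : Prop :=
  x ∈ P.feasible ∧ P.objective x < ⊤ ∧ ∀ x' ∈ P.feasible, P.objective x ≤ P.objective x'

end AggProblem

/-- Weight matrices of a graph: `W_ij < 0` on edges, `W_ij = 0` for distinct non-adjacent `i, j`,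
and `W_ii = -∑_{j ≠ i} W_ij`. -/
structure IsWeightMatrix {N : ℕ} (G : SimpleGraph (Fin N)) (W : Matrix (Fin N) (Fin N) ℝ) :
    Prop where
  neg : ∀ i j, G.Adj i j → W i j < 0
  zero : ∀ i j, i ≠ j → ¬ G.Adj i j → W i j = 0
  diag : ∀ i, W i i = -∑ j ∈ Finset.univ.erase i, W i j

/-- Incidence matrix over the directed edges: `+1` at the head, `-1` at the tail. An undirected
edge gives two directed edges. -/
def incidence {N : ℕ} (G : SimpleGraph (Fin N)) : Matrix (Fin N) G.Dart ℝ :=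
  fun i e => (if e.snd = i then 1 else 0) - (if e.fst = i then 1 else 0)

namespace AggProblem

variable {N l : ℕ} (P : AggProblem N l) (G : SimpleGraph (Fin N))

/-- The variables `ω`: `y_i` for each agent, then, for each directed edge `(i, j)`, the
multiplier `μ_ij` and agent `j`'s estimate `y_ij` of `y_i`. -/
abbrev Omega (_P : AggProblem N l) (G : SimpleGraph (Fin N)) : Type :=
  (Fin N → Fin l → ℝ) × (G.Dart → Fin l → ℝ) × (G.Dart → Fin l → ℝ)

/-- The stacked variable `ψ = [x; σ; λ; ω]`. -/
abbrev Stack : Type :=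
  P.Decision × (Fin N → Fin l → ℝ) × (G.Dart → Fin l → ℝ) × P.Omega G

variable {P G}

/-- Block `x` of `ψ`. -/
abbrev Stack.x (ψ : P.Stack G) : P.Decision := ψ.1
/-- Block `σ` of `ψ`. -/
abbrev Stack.sig (ψ : P.Stack G) : Fin N → Fin l → ℝ := ψ.2.1
/-- Block `λ` of `ψ`. -/
abbrev Stack.lam (ψ : P.Stack G) : G.Dart → Fin l → ℝ := ψ.2.2.1
/-- Block `y` of `ω`. -/
abbrev Stack.y (ψ : P.Stack G) : Fin N → Fin l → ℝ := ψ.2.2.2.1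
/-- Block `μ` of `ω`. -/
abbrev Stack.mu (ψ : P.Stack G) : G.Dart → Fin l → ℝ := ψ.2.2.2.2.1
/-- Block of the local estimates `y_ij` of `ω`. -/
abbrev Stack.est (ψ : P.Stack G) : G.Dart → Fin l → ℝ := ψ.2.2.2.2.2

variable (P G) [DecidableRel G.Adj]

/-- Euclidean inner product of two stacked vectors. -/
def stackInner (u v : P.Stack G) : ℝ :=
  ∑ i, u.x i ⬝ᵥ v.x i + ∑ i, u.sig i ⬝ᵥ v.sig i + ∑ e, u.lam e ⬝ᵥ v.lam e
    + ∑ i, u.y i ⬝ᵥ v.y i + ∑ e, u.mu e ⬝ᵥ v.mu e + ∑ e, u.est e ⬝ᵥ v.est e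

/-- The convex subdifferential of `F` at `ψ`; it is empty outside the effective domain. -/
def subdifferential (F : P.Stack G → WithTop ℝ) (ψ : P.Stack G) : Set (P.Stack G) :=
  {u | F ψ < ⊤ ∧ ∀ ψ' : P.Stack G, F ψ + ((P.stackInner G u (ψ' - ψ) : ℝ) : WithTop ℝ) ≤ F ψ'}

/-- `Q_i`: the pairs with `A_i x_i + σ_i ≤ c`. -/
def setQ (i : Fin N) : Set ((Fin (P.n i) → ℝ) × (Fin l → ℝ)) :=
  {p | P.A i *ᵥ p.1 + p.2 ≤ P.c}

/-- `F_i`, seen as a condition on `ψ`: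
`(N-1) A_i x_i - σ_i = W_ii y_i + ∑_{(j,i) ∈ E} W_ji y_ji`. -/
def setF (W : Matrix (Fin N) (Fin N) ℝ) (i : Fin N) : Set (P.Stack G) :=
  {ψ | ((N : ℝ) - 1) • (P.A i *ᵥ ψ.x i) - ψ.sig i
      = W i i • ψ.y i + ∑ e : G.Dart with e.snd = i, W e.fst i • ψ.est e}

/-- `∑_i (J_i(x_i, σ_i) + ι_{X_i}(x_i) + ι_{Q_i}(x_i, σ_i) + ι_{F_i}(x_i, σ_i, y_i))`, the part of
the network Lagrangian without the multiplier terms. -/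
def primalPart (W : Matrix (Fin N) (Fin N) ℝ) (ψ : P.Stack G) : WithTop ℝ :=
  ∑ i, (P.J i (ψ.x i, ψ.sig i) + convIndicator (P.X i) (ψ.x i)
    + convIndicator (P.setQ i) (ψ.x i, ψ.sig i) + convIndicator (P.setF G W i) ψ)

/-- The skew-symmetric linear part of the operator: the partial gradients of
`∑_{(j,i) ∈ E} (λ_ji ⬝ (A_i x_i + σ_i - A_j x_j - σ_j) + μ_ji ⬝ (y_ji - y_j))`, with the sign of
the rows of the dual variables `λ`, `μ` reversed. -/
def skewPart (ψ : P.Stack G) : P.Stack G :=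
  (fun i => (P.A i)ᵀ *ᵥ ∑ e, incidence G i e • ψ.lam e,
   fun i => ∑ e, incidence G i e • ψ.lam e,
   fun e => -∑ i, incidence G i e • (P.A i *ᵥ ψ.x i) - ∑ i, incidence G i e • ψ.sig i,
   fun i => -∑ e : G.Dart with e.fst = i, ψ.mu e,
   fun e => ψ.y e.fst - ψ.est e,
   fun e => ψ.mu e)

/-- The set-valued operator `T`. -/
def opT (W : Matrix (Fin N) (Fin N) ℝ) (ψ : P.Stack G) : Set (P.Stack G) :=
  {w | ∃ u ∈ P.subdifferential G (P.primalPart G W) ψ, w = u + P.skewPart G ψ}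

/-- The zero set of `T`. -/
def zerT (W : Matrix (Fin N) (Fin N) ℝ) : Set (P.Stack G) :=
  {ψ | 0 ∈ P.opT G W ψ}

end AggProblem

end

open scoped Matrix

noncomputable section

/-! ### Lagrange multipliers for affine constraints -/

section Multipliers

variable {V : Type*} [AddCommGroup V] [Module ℝ V]

/-- Real-valued affine functions on a real vector space. -/
def IsAffineFun (g : V → ℝ) : Prop :=
  ∀ (x y : V) (a b : ℝ), a + b = 1 → g (a • x + b • y) = a * g x + b * g y

/-- Algebraic relative interior points: segments of `C` ending at `z` extend beyond `z`. -/
def IsRelIntPoint (C : Set V) (z : V) : Prop :=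
  z ∈ C ∧ ∀ w ∈ C, ∃ ε : ℝ, 0 < ε ∧ z + ε • (z - w) ∈ C

namespace IsAffineFun

variable {g h : V → ℝ}

lemma neg (hg : IsAffineFun g) : IsAffineFun (fun x => -g x) := by
  intro x y a b hab
  simp only [hg x y a b hab]; ring

lemma sum {ι : Type*} (s : Finset ι) {g : ι → V → ℝ} (μ : ι → ℝ) (hg : ∀ k, IsAffineFun (g k)) :
    IsAffineFun (fun x => ∑ k ∈ s, μ k * g k x) := by
  intro x y a b hab
  simp only [hg _ x y a b hab, Finset.mul_sum, ← Finset.sum_add_distrib]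
  exact Finset.sum_congr rfl fun k _ => by ring

lemma add (hg : IsAffineFun g) (hh : IsAffineFun h) : IsAffineFun (fun x => g x + h x) := by
  intro x y a b hab
  simp only [hg x y a b hab, hh x y a b hab]; ring

lemma convexOn (hg : IsAffineFun g) {C : Set V} (hC : Convex ℝ C) : ConvexOn ℝ C g :=
  ⟨hC, fun x _ y _ a b _ _ hab => (hg x y a b hab).le⟩

lemma apply_extend (hg : IsAffineFun g) (z w : V) (t : ℝ) :
    g (z + t • (z - w)) = g z + t * (g z - g w) := by
  have h := hg z w (1 + t) (-t) (by ring)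
  rw [show z + t • (z - w) = (1 + t) • z + (-t) • w by module, h]; ring

lemma convex_eq_zero (hg : IsAffineFun g) {C : Set V} (hC : Convex ℝ C) :
    Convex ℝ (C ∩ {x | g x = 0}) := by
  rintro x ⟨hx, hx'⟩ y ⟨hy, hy'⟩ a b ha hb hab
  refine ⟨hC hx hy ha hb hab, ?_⟩
  simp only [Set.mem_ofPred_eq] at *
  rw [hg x y a b hab, hx', hy']; ring

lemma convex_le_zero (hg : IsAffineFun g) {C : Set V} (hC : Convex ℝ C) :
    Convex ℝ (C ∩ {x | g x ≤ 0}) := by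
  rintro x ⟨hx, hx'⟩ y ⟨hy, hy'⟩ a b ha hb hab
  refine ⟨hC hx hy ha hb hab, ?_⟩
  simp only [Set.mem_ofPred_eq] at *
  rw [hg x y a b hab]
  nlinarith

end IsAffineFun

namespace IsRelIntPoint

variable {C : Set V} {z : V} {g : V → ℝ}

lemma exists_forall_le (hz : IsRelIntPoint C z) (hC : Convex ℝ C) {w : V} (hw : w ∈ C) :
    ∃ ε : ℝ, 0 < ε ∧ ∀ t, 0 ≤ t → t ≤ ε → z + t • (z - w) ∈ C := by
  obtain ⟨ε, hε, h⟩ := hz.2 w hw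
  refine ⟨ε, hε, fun t ht hte => ?_⟩
  have := hC hz.1 h (a := 1 - t / ε) (b := t / ε) (by rw [sub_nonneg, div_le_one hε]; exact hte)
    (by positivity) (by ring)
  convert this using 1
  rw [smul_add, smul_smul, div_mul_cancel₀ t hε.ne']
  module

lemma midpoint (hz : IsRelIntPoint C z) (hC : Convex ℝ C) {v : V} (hv : v ∈ C) :
    IsRelIntPoint C ((1 / 2 : ℝ) • z + (1 / 2 : ℝ) • v) := by
  refine ⟨hC hz.1 hv (by norm_num) (by norm_num) (by norm_num), fun w hw => ?_⟩
  obtain ⟨δ, hδ, h⟩ := hz.2 w hw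
  refine ⟨δ / (2 + δ), by positivity, ?_⟩
  have := hC h hv (a := 1 / (2 + δ)) (b := (1 + δ) / (2 + δ)) (by positivity) (by positivity)
    (by field_simp; ring)
  convert this using 1
  match_scalars <;> field_simp <;> ring

lemma inter_eq_zero (hz : IsRelIntPoint C z) (hg : IsAffineFun g) (h0 : g z = 0) :
    IsRelIntPoint (C ∩ {x | g x = 0}) z := by
  refine ⟨⟨hz.1, h0⟩, fun w hw => ?_⟩
  obtain ⟨ε, hε, h⟩ := hz.2 w hw.1
  refine ⟨ε, hε, h, ?_⟩
  have hw2 : g w = 0 := hw.2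
  simp [hg.apply_extend, h0, hw2]

lemma inter_le_zero (hz : IsRelIntPoint C z) (hC : Convex ℝ C) (hg : IsAffineFun g)
    (h0 : g z < 0) : IsRelIntPoint (C ∩ {x | g x ≤ 0}) z := by
  refine ⟨⟨hz.1, h0.le⟩, fun w hw => ?_⟩
  obtain ⟨ε, hε, h⟩ := hz.exists_forall_le hC hw.1
  have hw2 : g w ≤ 0 := hw.2
  have hd : 0 < 1 - g w := by linarith
  refine ⟨min ε (-g z / (1 - g w)), lt_min hε (div_pos (by linarith) hd),
    h _ (le_min hε.le (div_nonneg (by linarith) hd.le)) (min_le_left _ _), ?_⟩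
  simp only [Set.mem_ofPred_eq, hg.apply_extend]
  set t := min ε (-g z / (1 - g w))
  have h1 : t * (1 - g w) ≤ -g z := (le_div_iff₀ hd).1 (min_le_right _ _)
  have h2 : 0 ≤ t := le_min hε.le (div_nonneg (by linarith) hd.le)
  nlinarith

/-- An affine function that is nonnegative on `C` and vanishes at a relative interior point
vanishes on `C`. -/
lemma eq_zero_of_nonneg (hz : IsRelIntPoint C z) (hg : IsAffineFun g)
    (hn : ∀ w ∈ C, 0 ≤ g w) (h0 : g z = 0) {w : V} (hw : w ∈ C) : g w = 0 := by
  obtain ⟨ε, hε, h⟩ := hz.2 w hw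
  have h1 := hn _ h
  rw [hg.apply_extend, h0] at h1
  have h2 := hn w hw
  nlinarith

end IsRelIntPoint

variable {C : Set V} {f g : V → ℝ}

lemma ConvexOn.exists_multiplier_of_signs (hf : ConvexOn ℝ C f) (hg : IsAffineFun g)
    (h0 : ∀ w ∈ C, g w = 0 → 0 ≤ f w) {p q : V} (hp : p ∈ C) (hgp : 0 < g p) (hq : q ∈ C)
    (hgq : g q < 0) : ∃ β : ℝ, ∀ w ∈ C, 0 ≤ f w + β * g w := by
  have key : ∀ p ∈ C, 0 < g p → ∀ q ∈ C, g q < 0 → -f p / g p ≤ f q / (-g q) := by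
    intro p hp hgp q hq hgq
    have hd : 0 < g p - g q := by linarith
    have ha : 0 ≤ -g q / (g p - g q) := div_nonneg (by linarith) hd.le
    have hb : 0 ≤ g p / (g p - g q) := div_nonneg hgp.le hd.le
    have hab : -g q / (g p - g q) + g p / (g p - g q) = 1 := by field_simp; ring
    have h1 := h0 _ (hf.1 hp hq ha hb hab) (by rw [hg p q _ _ hab]; field_simp; ring)
    have h2 := h1.trans (hf.2 hp hq ha hb hab)
    simp only [smul_eq_mul] at h2
    have h3 : 0 ≤ (-g q) * f p + g p * f q := by
      have := mul_nonneg h2 hd.le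
      have e : (-g q / (g p - g q) * f p + g p / (g p - g q) * f q) * (g p - g q)
          = (-g q) * f p + g p * f q := by field_simp
      linarith
    rw [div_le_div_iff₀ hgp (by linarith)]
    linarith
  set S : Set ℝ := (fun w => -f w / g w) '' {w | w ∈ C ∧ 0 < g w}
  have hS : S.Nonempty := ⟨_, p, ⟨hp, hgp⟩, rfl⟩
  have hub : ∀ q ∈ C, g q < 0 → ∀ b ∈ S, b ≤ f q / (-g q) := by
    rintro q hq hgq _ ⟨w, hw, rfl⟩
    exact key w hw.1 hw.2 q hq hgq
  refine ⟨sSup S, fun w hw => ?_⟩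
  rcases lt_trichotomy (g w) 0 with h | h | h
  · have := csSup_le hS (hub w hw h)
    rw [le_div_iff₀ (by linarith)] at this
    linarith
  · simpa [h] using h0 w hw h
  · have := le_csSup ⟨_, hub q hq hgq⟩ (⟨w, ⟨hw, h⟩, rfl⟩ : -f w / g w ∈ S)
    rw [div_le_iff₀ h] at this
    linarith

lemma ConvexOn.exists_multiplier_eq (hf : ConvexOn ℝ C f) (hg : IsAffineFun g) {z : V}
    (hz : IsRelIntPoint C z) (hgz : g z = 0) (h0 : ∀ w ∈ C, g w = 0 → 0 ≤ f w) :
    ∃ β : ℝ, ∀ w ∈ C, 0 ≤ f w + β * g w := by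
  by_cases hn : ∀ w ∈ C, 0 ≤ g w
  · exact ⟨0, fun w hw => by simpa using h0 w hw (hz.eq_zero_of_nonneg hg hn hgz hw)⟩
  by_cases hp : ∀ w ∈ C, 0 ≤ -g w
  · refine ⟨0, fun w hw => ?_⟩
    have := hz.eq_zero_of_nonneg hg.neg hp (by simp [hgz]) hw
    simpa using h0 w hw (by linarith)
  push Not at hn hp
  obtain ⟨q, hq, hgq⟩ := hn
  obtain ⟨p, hp, hgp⟩ := hp
  exact hf.exists_multiplier_of_signs hg h0 hp (by linarith) hq hgq

lemma ConvexOn.exists_multiplier_le (hf : ConvexOn ℝ C f) (hg : IsAffineFun g) {z : V}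
    (hz : z ∈ C) (hgz : g z < 0) (h0 : ∀ w ∈ C, g w ≤ 0 → 0 ≤ f w) :
    ∃ β : ℝ, 0 ≤ β ∧ ∀ w ∈ C, 0 ≤ f w + β * g w := by
  by_cases hp : ∀ w ∈ C, g w ≤ 0
  · exact ⟨0, le_rfl, fun w hw => by simpa using h0 w hw (hp w hw)⟩
  push Not at hp
  obtain ⟨p, hp, hgp⟩ := hp
  obtain ⟨β, hβ⟩ := hf.exists_multiplier_of_signs hg (fun w hw h => h0 w hw h.le) hp hgp hz hgz
  refine ⟨max β 0, le_max_right _ _, fun w hw => ?_⟩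
  rcases le_or_gt (g w) 0 with h | h
  · rcases max_choice β 0 with e | e <;> rw [e]
    · exact hβ w hw
    · simpa using h0 w hw h
  · nlinarith [hβ w hw, le_max_left β 0]

/-- Convex duality with finitely many affine inequality constraints. Only a feasible relative
interior point is required, not a strictly feasible one. -/
theorem exists_multipliers_of_affine_le {ι : Type*} (s : Finset ι) {g : ι → V → ℝ}
    (hg : ∀ k, IsAffineFun (g k)) :
    ∀ {C : Set V} {f : V → ℝ} {z : V}, ConvexOn ℝ C f → IsRelIntPoint C z →
      (∀ k ∈ s, g k z ≤ 0) → (∀ w ∈ C, (∀ k ∈ s, g k w ≤ 0) → 0 ≤ f w) →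
      ∃ μ : ι → ℝ, (∀ k, 0 ≤ μ k) ∧ ∀ w ∈ C, 0 ≤ f w + ∑ k ∈ s, μ k * g k w := by
  classical
  induction s using Finset.induction_on with
  | empty =>
    intro C f z _ _ _ h
    exact ⟨0, fun _ => le_rfl, fun w hw => by simpa using h w hw (by simp)⟩
  | insert m s hm ih =>
    intro C f z hf hz hgz h
    have upd : ∀ (ν : ι → ℝ) (β : ℝ) (w : V),
        ∑ k ∈ insert m s, Function.update ν m β k * g k w
          = β * g m w + ∑ k ∈ s, ν k * g k w := by
      intro ν β w
      rw [Finset.sum_insert hm, Function.update_self]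
      congr 1
      refine Finset.sum_congr rfl fun k hk => ?_
      rw [Function.update_of_ne (ne_of_mem_of_not_mem hk hm)]
    have updn : ∀ (ν : ι → ℝ) (β : ℝ), (∀ k, 0 ≤ ν k) → 0 ≤ β →
        ∀ k, 0 ≤ Function.update ν m β k := by
      intro ν β hν hβ k
      by_cases e : k = m
      · subst e; simpa using hβ
      · rw [Function.update_of_ne e]; exact hν k
    have hs : ∀ k ∈ s, g k z ≤ 0 := fun k hk => hgz k (Finset.mem_insert_of_mem hk)
    have hmz : g m z ≤ 0 := hgz m (Finset.mem_insert_self _ _)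
    by_cases hc : ∀ w ∈ C, (∀ k ∈ s, g k w ≤ 0) → 0 ≤ g m w
    · obtain ⟨μ, hμ, hμC⟩ := ih ((hg m).convexOn hf.1) hz hs hc
      have haff : IsAffineFun (fun w => g m w + ∑ k ∈ s, μ k * g k w) :=
        (hg m).add (IsAffineFun.sum s μ hg)
      have hsum : ∑ k ∈ s, μ k * g k z ≤ 0 :=
        Finset.sum_nonpos fun k hk => mul_nonpos_of_nonneg_of_nonpos (hμ k) (hs k hk)
      have hz0 := hμC z hz.1
      have hzero := fun w hw => hz.eq_zero_of_nonneg haff hμC (by linarith) (w := w) hw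
      have hmz0 : g m z = 0 := by linarith
      obtain ⟨ν, hν, hνC⟩ := ih (f := f)
        (hf.subset Set.inter_subset_left ((hg m).convex_eq_zero hf.1))
        (hz.inter_eq_zero (hg m) hmz0) hs (fun w hw hw' => h w hw.1 fun k hk => by
          rcases Finset.mem_insert.1 hk with rfl | hk
          · exact le_of_eq hw.2
          · exact hw' k hk)
      obtain ⟨β, hβ⟩ := (hf.add ((IsAffineFun.sum s ν hg).convexOn hf.1)).exists_multiplier_eq
        (hg m) hz hmz0 (fun w hw h0 => hνC w ⟨hw, h0⟩)
      rcases le_or_gt 0 β with hb | hb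
      · refine ⟨Function.update ν m β, updn ν β hν hb, fun w hw => ?_⟩
        have := hβ w hw
        simp only [Pi.add_apply] at this
        rw [upd]; linarith
      · refine ⟨Function.update (fun k => ν k + (-β) * μ k) m 0,
          updn _ _ (fun k => add_nonneg (hν k) (mul_nonneg (by linarith) (hμ k))) le_rfl,
          fun w hw => ?_⟩
        have h1 := hβ w hw
        have h2 := hzero w hw
        simp only [Pi.add_apply] at h1
        have h3 : ∑ k ∈ s, (ν k + -β * μ k) * g k w
            = ∑ k ∈ s, ν k * g k w + -β * ∑ k ∈ s, μ k * g k w := by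
          rw [Finset.mul_sum, ← Finset.sum_add_distrib]
          exact Finset.sum_congr rfl fun k _ => by ring
        have h4 : g m w = -∑ k ∈ s, μ k * g k w := by linarith
        rw [upd, h3]
        rw [h4] at h1
        linarith
    · push Not at hc
      obtain ⟨v, hv, hvs, hvm⟩ := hc
      have hz' := hz.midpoint hf.1 hv
      have gm : ∀ k, g k ((1 / 2 : ℝ) • z + (1 / 2 : ℝ) • v) = 1 / 2 * g k z + 1 / 2 * g k v :=
        fun k => hg k _ _ _ _ (by norm_num)
      have hmz' : g m ((1 / 2 : ℝ) • z + (1 / 2 : ℝ) • v) < 0 := by rw [gm]; linarith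
      obtain ⟨ν, hν, hνC⟩ := ih (f := f)
        (hf.subset Set.inter_subset_left ((hg m).convex_le_zero hf.1))
        (hz'.inter_le_zero hf.1 (hg m) hmz')
        (fun k hk => by rw [gm]; linarith [hs k hk, hvs k hk])
        (fun w hw hw' => h w hw.1 fun k hk => by
          rcases Finset.mem_insert.1 hk with rfl | hk
          · exact hw.2
          · exact hw' k hk)
      obtain ⟨β, hb, hβ⟩ := (hf.add ((IsAffineFun.sum s ν hg).convexOn hf.1)).exists_multiplier_le
        (hg m) hz'.1 hmz' (fun w hw h0 => hνC w ⟨hw, h0⟩)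
      refine ⟨Function.update ν m β, updn ν β hν hb, fun w hw => ?_⟩
      have := hβ w hw
      simp only [Pi.add_apply] at this
      rw [upd]; linarith

/-- Multipliers for affine equality constraints `h = 0` in the presence of affine inequality
constraints `g ≤ 0` that are kept as explicit constraints. -/
theorem exists_multipliers_of_affine_eq {ι κ : Type*} [Fintype ι] [Fintype κ] {g : ι → V → ℝ}
    {h : κ → V → ℝ} (hg : ∀ k, IsAffineFun (g k)) (hh : ∀ k, IsAffineFun (h k))
    {z : V} (hf : ConvexOn ℝ C f) (hz : IsRelIntPoint C z) (hgz : ∀ k, g k z ≤ 0)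
    (hhz : ∀ k, h k z = 0) (hmin : ∀ w ∈ C, (∀ k, g k w ≤ 0) → (∀ k, h k w = 0) → 0 ≤ f w) :
    ∃ ν : κ → ℝ, ∀ w ∈ C, (∀ k, g k w ≤ 0) → 0 ≤ f w + ∑ k, ν k * h k w := by
  obtain ⟨μ, hμ, H⟩ := exists_multipliers_of_affine_le (Finset.univ : Finset (ι ⊕ κ ⊕ κ))
    (g := Sum.elim g (Sum.elim h fun k x => -h k x))
    (by rintro (k | k | k); exacts [hg k, hh k, (hh k).neg]) hf hz
    (by rintro (k | k | k) -; exacts [hgz k, (hhz k).le, by simp [hhz k]])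
    (fun w hw hk => hmin w hw (fun k => hk (Sum.inl k) (Finset.mem_univ _)) fun k =>
      le_antisymm (hk (Sum.inr (Sum.inl k)) (Finset.mem_univ _))
        (by simpa using hk (Sum.inr (Sum.inr k)) (Finset.mem_univ _)))
  refine ⟨fun k => μ (Sum.inr (Sum.inl k)) - μ (Sum.inr (Sum.inr k)), fun w hw hgw => ?_⟩
  have h1 := H w hw
  simp only [Fintype.sum_sum_type, Sum.elim_inl, Sum.elim_inr, mul_neg,
    Finset.sum_neg_distrib] at h1
  have h2 : ∑ k, μ (Sum.inl k) * g k w ≤ 0 :=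
    Finset.sum_nonpos fun k _ => mul_nonpos_of_nonneg_of_nonpos (hμ _) (hgw k)
  simp only [sub_mul, Finset.sum_sub_distrib]
  linarith

end Multipliers

lemma IsRelIntPoint.of_mem_intrinsicInterior {V : Type*} [AddCommGroup V] [Module ℝ V]
    [TopologicalSpace V] [IsTopologicalAddGroup V] [ContinuousSMul ℝ V] {C : Set V} {z : V}
    (hz : z ∈ intrinsicInterior ℝ C) : IsRelIntPoint C z := by
  refine ⟨intrinsicInterior_subset hz, fun w hw => ?_⟩
  obtain ⟨y, hy, rfl⟩ := mem_intrinsicInterior.1 hz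
  have hmem : ∀ t : ℝ, (y : V) + t • ((y : V) - w) ∈ affineSpan ℝ C := by
    intro t
    have h := AffineMap.lineMap_mem (-t) y.2 (subset_affineSpan ℝ C hw)
    rw [AffineMap.lineMap_apply_module] at h
    convert h using 1
    module
  let φ : ℝ → affineSpan ℝ C := fun t => ⟨(y : V) + t • ((y : V) - w), hmem t⟩
  have hφ : Continuous φ := by
    refine Continuous.subtype_mk ?_ _
    fun_prop
  have h0 : φ 0 = y := by ext; simp [φ]
  have hnhds : ∀ᶠ t in nhds (0 : ℝ), φ t ∈ ((↑) ⁻¹' C : Set (affineSpan ℝ C)) :=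
    hφ.continuousAt.eventually_mem (by rw [h0]; exact mem_interior_iff_mem_nhds.1 hy)
  obtain ⟨ε, hε, h⟩ := Metric.eventually_nhds_iff.1 hnhds
  exact ⟨ε / 2, by positivity, h (by simp [abs_of_pos hε]; linarith)⟩

/-! ### Graphs and weight matrices -/

namespace SimpleGraph

variable {V : Type*} {G : SimpleGraph V}

lemma Connected.eq_of_forall_adj {α : Type*} (hG : G.Connected) {t : V → α}
    (h : ∀ i j, G.Adj i j → t i = t j) (i j : V) : t i = t j := by
  obtain ⟨p⟩ := hG.preconnected i j
  induction p with
  | nil => rfl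
  | cons hadj _ ih => exact (h _ _ hadj).trans ih

lemma sum_darts_snd_eq [Fintype V] [DecidableEq V] [DecidableRel G.Adj]
    {M : Type*} [AddCommMonoid M] (i : V) (F : V → M) :
    ∑ e : G.Dart with e.snd = i, F e.fst = ∑ j with G.Adj j i, F j := by
  refine Finset.sum_bij' (fun e _ => e.fst)
    (fun j hj => ⟨(j, i), (Finset.mem_filter.1 hj).2⟩) ?_ ?_ ?_ ?_ ?_
  · intro e he
    have h := e.adj
    rw [(Finset.mem_filter.1 he).2] at h
    simpa using h
  · intro j hj; simp
  · intro e he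
    ext
    · rfl
    · exact (Finset.mem_filter.1 he).2.symm
  · intro j hj; rfl
  · intro e he; rfl

end SimpleGraph

namespace IsWeightMatrix

variable {N : ℕ} {G : SimpleGraph (Fin N)} {W : Matrix (Fin N) (Fin N) ℝ}

lemma sum_row (hW : IsWeightMatrix G W) (i : Fin N) : ∑ j, W i j = 0 := by
  rw [← Finset.add_sum_erase _ _ (Finset.mem_univ i), hW.diag i]; ring

lemma eq_of_mulVec_eq_zero (hW : IsWeightMatrix G W) (hG : G.Connected) {w : Fin N → ℝ}
    (h : W *ᵥ w = 0) (i j : Fin N) : w i = w j := by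
  have : Nonempty (Fin N) := ⟨i⟩
  obtain ⟨m, hm⟩ := Finite.exists_max w
  have step : ∀ a b, G.Adj a b → (w a = w m) → w b = w m := by
    intro a b hab ha
    have h1 : ∑ k, W a k * (w k - w m) = 0 := by
      have h2 : ∑ k, W a k * w k = 0 := congrFun h a
      simp only [mul_sub, Finset.sum_sub_distrib, ← Finset.sum_mul, hW.sum_row, h2]
      ring
    have h3 : ∀ k ∈ Finset.univ, 0 ≤ W a k * (w k - w m) := by
      intro k _
      by_cases hk : k = a
      · subst hk; simp [ha]
      by_cases hak : G.Adj a k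
      · exact mul_nonneg_of_nonpos_of_nonpos (hW.neg a k hak).le (by linarith [hm k])
      · simp [hW.zero a k (Ne.symm hk) hak]
    have h4 := (Finset.sum_eq_zero_iff_of_nonneg h3).1 h1 b (Finset.mem_univ b)
    rcases mul_eq_zero.1 h4 with h5 | h5
    · exact absurd h5 (hW.neg a b hab).ne
    · linarith
  have all : ∀ k, (w k = w m) = (w m = w m) := fun k =>
    hG.eq_of_forall_adj (t := fun k => (w k = w m))
      (fun a b hab => propext ⟨step a b hab, step b a hab.symm⟩) k m
  have e : ∀ k, w k = w m := fun k => (all k).mpr rfl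
  rw [e i, e j]

/-- The range of `Wᵀ` consists of all vectors with zero sum. -/
lemma exists_transpose_mulVec_eq (hW : IsWeightMatrix G W) (hG : G.Connected) {v : Fin N → ℝ}
    (hv : ∑ i, v i = 0) : ∃ y, Wᵀ *ᵥ y = v := by
  by_contra hne
  have hnot : v ∉ LinearMap.range (Matrix.mulVecLin Wᵀ) := by
    rintro ⟨y, hy⟩
    exact hne ⟨y, hy⟩
  obtain ⟨φ, hφv, hφ⟩ := Submodule.exists_le_ker_of_notMem hnot
  set w : Fin N → ℝ := fun i => φ (Pi.single i 1) with hw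
  have hφw : ∀ u, φ u = u ⬝ᵥ w := by
    intro u
    rw [LinearMap.pi_apply_eq_sum_univ φ u]
    simp only [dotProduct, smul_eq_mul, hw]
    refine Finset.sum_congr rfl fun i _ => ?_
    congr 2
    ext j; simp [Pi.single_apply, eq_comm]
  have hker : W *ᵥ w = 0 := by
    refine dotProduct_eq_zero_iff.1 fun u => ?_
    have h1 : φ (Wᵀ *ᵥ u) = 0 := hφ ⟨u, rfl⟩
    rw [hφw, Matrix.mulVec_transpose, ← Matrix.dotProduct_mulVec] at h1
    rwa [dotProduct_comm]
  apply hφv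
  rw [hφw]
  rcases isEmpty_or_nonempty (Fin N) with hE | ⟨⟨i₀⟩⟩
  · simp [dotProduct]
  · have : ∀ i, w i = w i₀ := fun i => hW.eq_of_mulVec_eq_zero hG hker i i₀
    simp only [dotProduct, this, ← Finset.sum_mul, hv, zero_mul]

lemma diag_add_sum_darts [DecidableRel G.Adj] (hW : IsWeightMatrix G W) {l : ℕ}
    (y : Fin N → Fin l → ℝ) (i : Fin N) :
    W i i • y i + ∑ e : G.Dart with e.snd = i, W e.fst i • y e.fst = ∑ j, W j i • y j := by
  rw [SimpleGraph.sum_darts_snd_eq i (fun j => W j i • y j),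
    ← Finset.add_sum_erase _ _ (Finset.mem_univ i)]
  congr 1
  refine Finset.sum_subset_zero_on_sdiff ?_ ?_ fun _ _ => rfl
  · intro j hj
    have : G.Adj j i := by simpa using hj
    simpa using this.ne
  · intro j hj
    simp only [Finset.mem_sdiff, Finset.mem_erase, Finset.mem_univ, and_true,
      Finset.mem_filter, true_and] at hj
    simp [hW.zero j i hj.1 hj.2]

lemma exists_diag_add_sum_darts_eq [DecidableRel G.Adj] (hW : IsWeightMatrix G W)
    (hG : G.Connected) {l : ℕ} {v : Fin N → Fin l → ℝ} (hv : ∑ i, v i = 0) :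
    ∃ y : Fin N → Fin l → ℝ, ∀ i,
      W i i • y i + ∑ e : G.Dart with e.snd = i, W e.fst i • y e.fst = v i := by
  have h : ∀ k, ∃ y : Fin N → ℝ, Wᵀ *ᵥ y = fun i => v i k := fun k =>
    hW.exists_transpose_mulVec_eq hG (by simpa using congrFun hv k)
  choose y hy using h
  refine ⟨fun i k => y k i, fun i => ?_⟩
  rw [hW.diag_add_sum_darts (fun i k => y k i)]
  ext k
  have := congrFun (hy k) i
  simpa [Matrix.mulVec, dotProduct] using this

end IsWeightMatrix

lemma sum_incidence_smul {N : ℕ} (G : SimpleGraph (Fin N)) {M : Type*} [AddCommGroup M]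
    [Module ℝ M] (e : G.Dart) (F : Fin N → M) :
    ∑ i, incidence G i e • F i = F e.snd - F e.fst := by
  simp [incidence, sub_smul, Finset.sum_sub_distrib]

namespace AggProblem

variable {N l : ℕ} (P : AggProblem N l) {G : SimpleGraph (Fin N)}

/-- Disagreement of the two ends of a directed edge on `A_i x_i + σ_i`. -/
def gap (ψ : P.Stack G) (e : G.Dart) : Fin l → ℝ :=
  (P.A e.snd *ᵥ ψ.x e.snd + ψ.sig e.snd) - (P.A e.fst *ᵥ ψ.x e.fst + ψ.sig e.fst)

/-- Error of the estimate of `y_j` held at the head of a directed edge `(j, i)`. -/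
def estErr (ψ : P.Stack G) (e : G.Dart) : Fin l → ℝ :=
  ψ.est e - ψ.y e.fst

lemma gap_combo (ψ φ : P.Stack G) (a b : ℝ) (e : G.Dart) :
    P.gap (a • ψ + b • φ) e = a • P.gap ψ e + b • P.gap φ e := by
  simp only [gap, Stack.x, Stack.sig, Prod.fst_add, Prod.snd_add, Prod.smul_fst, Prod.smul_snd,
    Pi.add_apply, Pi.smul_apply, Matrix.mulVec_add, Matrix.mulVec_smul]
  module

lemma estErr_combo (ψ φ : P.Stack G) (a b : ℝ) (e : G.Dart) :
    P.estErr (a • ψ + b • φ) e = a • P.estErr ψ e + b • P.estErr φ e := by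
  simp only [estErr, Stack.y, Stack.est, Prod.fst_add, Prod.snd_add, Prod.smul_fst,
    Prod.smul_snd, Pi.add_apply, Pi.smul_apply]
  module

lemma gap_sub (ψ φ : P.Stack G) (e : G.Dart) : P.gap (ψ - φ) e = P.gap ψ e - P.gap φ e := by
  have := P.gap_combo ψ φ 1 (-1) e
  simpa [sub_eq_add_neg] using this

lemma estErr_sub (ψ φ : P.Stack G) (e : G.Dart) :
    P.estErr (ψ - φ) e = P.estErr ψ e - P.estErr φ e := by
  have := P.estErr_combo ψ φ 1 (-1) e
  simpa [sub_eq_add_neg] using this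

variable [DecidableRel G.Adj]

lemma stackInner_skewPart (ψ φ : P.Stack G) :
    P.stackInner G (P.skewPart G ψ) φ
      = ∑ e, ψ.lam e ⬝ᵥ P.gap φ e + ∑ e, ψ.mu e ⬝ᵥ P.estErr φ e
        - ∑ e, P.gap ψ e ⬝ᵥ φ.lam e - ∑ e, P.estErr ψ e ⬝ᵥ φ.mu e := by
  have hswap : ∀ a : Fin N → Fin l → ℝ,
      ∑ i, (∑ e, incidence G i e • ψ.lam e) ⬝ᵥ a i = ∑ e, ψ.lam e ⬝ᵥ (a e.snd - a e.fst) := by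
    intro a
    simp_rw [← sum_incidence_smul G, sum_dotProduct, dotProduct_sum, smul_dotProduct,
      dotProduct_smul]
    exact Finset.sum_comm
  have hx : ∑ i, ((P.A i)ᵀ *ᵥ ∑ e, incidence G i e • ψ.lam e) ⬝ᵥ φ.x i
      = ∑ e, ψ.lam e ⬝ᵥ (P.A e.snd *ᵥ φ.x e.snd - P.A e.fst *ᵥ φ.x e.fst) := by
    rw [← hswap fun i => P.A i *ᵥ φ.x i]
    refine Finset.sum_congr rfl fun i _ => ?_
    rw [Matrix.mulVec_transpose, Matrix.dotProduct_mulVec]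
  have hy : ∑ i, (-∑ e : G.Dart with e.fst = i, ψ.mu e) ⬝ᵥ φ.y i
      = -∑ e, ψ.mu e ⬝ᵥ φ.y e.fst := by
    simp_rw [neg_dotProduct, sum_dotProduct, Finset.sum_neg_distrib]
    rw [← Finset.sum_fiberwise Finset.univ (fun e : G.Dart => e.fst)]
    congr 1
    refine Finset.sum_congr rfl fun i _ => Finset.sum_congr rfl fun e he => ?_
    rw [(Finset.mem_filter.1 he).2]
  have hlam : ∀ e, (-∑ i, incidence G i e • (P.A i *ᵥ ψ.x i) - ∑ i, incidence G i e • ψ.sig i)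
      = -P.gap ψ e := by
    intro e
    rw [sum_incidence_smul G e fun i => P.A i *ᵥ ψ.x i, sum_incidence_smul G e ψ.sig, gap]
    abel
  have hmu : ∀ e, ψ.y e.fst - ψ.est e = -P.estErr ψ e := fun e => by simp [estErr]
  unfold stackInner
  change ∑ i, ((P.A i)ᵀ *ᵥ ∑ e, incidence G i e • ψ.lam e) ⬝ᵥ φ.x i
    + ∑ i, (∑ e, incidence G i e • ψ.lam e) ⬝ᵥ φ.sig i
    + ∑ e, (-∑ i, incidence G i e • (P.A i *ᵥ ψ.x i) - ∑ i, incidence G i e • ψ.sig i)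
      ⬝ᵥ φ.lam e
    + ∑ i, (-∑ e : G.Dart with e.fst = i, ψ.mu e) ⬝ᵥ φ.y i
    + ∑ e, (ψ.y e.fst - ψ.est e) ⬝ᵥ φ.mu e + ∑ e, ψ.mu e ⬝ᵥ φ.est e = _
  rw [hx, hswap, hy]
  simp_rw [hlam, hmu, neg_dotProduct, Finset.sum_neg_distrib]
  simp only [gap, estErr, dotProduct_sub, dotProduct_add, Finset.sum_sub_distrib,
    Finset.sum_add_distrib]
  ring

/-- Defect of the equation defining `F_i`. -/
def residual (W : Matrix (Fin N) (Fin N) ℝ) (i : Fin N) (ψ : P.Stack G) : Fin l → ℝ :=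
  ((N : ℝ) - 1) • (P.A i *ᵥ ψ.x i) - ψ.sig i
    - (W i i • ψ.y i + ∑ e : G.Dart with e.snd = i, W e.fst i • ψ.est e)

lemma mem_setF_iff {W : Matrix (Fin N) (Fin N) ℝ} {i : Fin N} {ψ : P.Stack G} :
    ψ ∈ P.setF G W i ↔ P.residual W i ψ = 0 :=
  sub_eq_zero.symm

lemma residual_combo (W : Matrix (Fin N) (Fin N) ℝ) (i : Fin N) (ψ φ : P.Stack G) (a b : ℝ) :
    P.residual W i (a • ψ + b • φ) = a • P.residual W i ψ + b • P.residual W i φ := by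
  simp only [residual, Stack.x, Stack.sig, Stack.y, Stack.est, Prod.fst_add, Prod.snd_add,
    Prod.smul_fst, Prod.smul_snd, Pi.add_apply, Pi.smul_apply, Matrix.mulVec_add,
    Matrix.mulVec_smul, smul_add, Finset.sum_add_distrib, smul_sub, Finset.smul_sum]
  simp only [smul_comm _ a, smul_comm _ b]
  abel

lemma combo_mem_setF {W : Matrix (Fin N) (Fin N) ℝ} {i : Fin N} {ψ φ : P.Stack G}
    (hψ : ψ ∈ P.setF G W i) (hφ : φ ∈ P.setF G W i) (a b : ℝ) :
    a • ψ + b • φ ∈ P.setF G W i := by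
  rw [mem_setF_iff] at *
  rw [residual_combo, hψ, hφ]; simp

/-- Real-valued version of `J_i`. -/
def objReal (i : Fin N) (p : (Fin (P.n i) → ℝ) × (Fin l → ℝ)) : ℝ :=
  (P.J i p).untopD 0

lemma coe_objReal {i : Fin N} {p : (Fin (P.n i) → ℝ) × (Fin l → ℝ)} (h : P.J i p < ⊤) :
    (P.objReal i p : WithTop ℝ) = P.J i p := by
  obtain ⟨r, hr⟩ := WithTop.ne_top_iff_exists.1 h.ne
  simp [objReal, ← hr]

lemma convexOn_objReal {i : Fin N} (hJ : IsCCPOn (P.objDomain i) (P.J i)) :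
    ConvexOn ℝ (effDomOn (P.objDomain i) (P.J i)) (P.objReal i) := by
  have key : ∀ p ∈ effDomOn (P.objDomain i) (P.J i), ∀ q ∈ effDomOn (P.objDomain i) (P.J i),
      ∀ a b : ℝ, 0 ≤ a → 0 ≤ b → a + b = 1 →
        (a • p + b • q, a * P.objReal i p + b * P.objReal i q)
          ∈ epigraphOn (P.objDomain i) (P.J i) := by
    intro p hp q hq a b ha hb hab
    exact hJ.convex (x := (p, P.objReal i p)) (y := (q, P.objReal i q))
      ⟨hp.1, (P.coe_objReal hp.2).ge⟩ ⟨hq.1, (P.coe_objReal hq.2).ge⟩ ha hb hab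
  refine ⟨fun p hp q hq a b ha hb hab => ?_, fun p hp q hq a b ha hb hab => ?_⟩
  · have h := key p hp q hq a b ha hb hab
    exact ⟨h.1, h.2.trans_lt (WithTop.coe_lt_top _)⟩
  · have h := key p hp q hq a b ha hb hab
    have h2 := h.2
    rw [← P.coe_objReal (h.2.trans_lt (WithTop.coe_lt_top _))] at h2
    exact WithTop.coe_le_coe.1 h2

/-- Finite part of the primal objective of the network Lagrangian. -/
def netObjReal (ψ : P.Stack G) : ℝ := ∑ i, P.objReal i (ψ.x i, ψ.sig i)

/-- The points satisfying the domain constraints and the equations `F_i`. -/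
def netDomain (W : Matrix (Fin N) (Fin N) ℝ) : Set (P.Stack G) :=
  {ψ | ∀ i, (ψ.x i, ψ.sig i) ∈ effDomOn (P.objDomain i) (P.J i) ∧ ψ ∈ P.setF G W i}

lemma primalPart_lt_top_iff {W : Matrix (Fin N) (Fin N) ℝ} {ψ : P.Stack G} :
    P.primalPart G W ψ < ⊤ ↔
      ψ ∈ P.netDomain W ∧ ∀ i, P.A i *ᵥ ψ.x i + ψ.sig i ≤ P.c := by
  have hind : ∀ {V : Type} (S : Set V) (p : V), convIndicator S p < ⊤ ↔ p ∈ S := by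
    intro V S p
    unfold convIndicator
    split_ifs with h <;> simp [h]
  simp only [primalPart, WithTop.sum_lt_top, WithTop.add_lt_top, hind, Finset.mem_univ,
    true_imp_iff, netDomain, effDomOn, objDomain, setQ, Set.mem_ofPred_eq, Set.mem_prod,
    Set.mem_univ, and_true]
  rw [← forall_and]
  exact forall_congr' fun i => by tauto

lemma primalPart_eq {W : Matrix (Fin N) (Fin N) ℝ} {ψ : P.Stack G}
    (h : ψ ∈ P.netDomain W) (hQ : ∀ i, P.A i *ᵥ ψ.x i + ψ.sig i ≤ P.c) :
    P.primalPart G W ψ = (P.netObjReal ψ : WithTop ℝ) := by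
  rw [netObjReal, WithTop.coe_sum, primalPart]
  refine Finset.sum_congr rfl fun i _ => ?_
  rw [P.coe_objReal (h i).1.2, convIndicator, convIndicator, convIndicator,
    if_pos (h i).1.1.1, if_pos (show _ ∈ P.setQ i from hQ i), if_pos (h i).2]
  simp

lemma mem_zerT_iff {W : Matrix (Fin N) (Fin N) ℝ} {ψ : P.Stack G} :
    ψ ∈ P.zerT G W ↔ (ψ ∈ P.netDomain W ∧ ∀ i, P.A i *ᵥ ψ.x i + ψ.sig i ≤ P.c) ∧
      ∀ ψ' ∈ P.netDomain (G := G) W, (∀ i, P.A i *ᵥ Stack.x ψ' i + Stack.sig ψ' i ≤ P.c) →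
        P.netObjReal ψ ≤ P.netObjReal ψ' + P.stackInner G (P.skewPart G ψ) (ψ' - ψ) := by
  have hneg : ∀ u v : P.Stack G, P.stackInner G (-u) v = -P.stackInner G u v := by
    intro u v
    simp only [stackInner, Stack.x, Stack.sig, Stack.lam, Stack.y, Stack.mu, Stack.est,
      Prod.fst_neg, Prod.snd_neg, Pi.neg_apply, neg_dotProduct, Finset.sum_neg_distrib]
    ring
  have h1 : ψ ∈ P.zerT G W ↔
      -P.skewPart G ψ ∈ P.subdifferential G (P.primalPart G W) ψ := by
    constructor
    · rintro ⟨u, hu, h⟩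
      rwa [← eq_neg_of_add_eq_zero_left h.symm]
    · intro h
      exact ⟨_, h, by simp⟩
  rw [h1]
  refine (and_congr P.primalPart_lt_top_iff Iff.rfl).trans (and_congr_right fun hψ => ?_)
  rw [P.primalPart_eq hψ.1 hψ.2]
  refine forall_congr' fun ψ' => ?_
  rw [hneg, ← WithTop.coe_add]
  constructor
  · intro h hd hQ
    rw [P.primalPart_eq hd hQ, WithTop.coe_le_coe] at h
    linarith
  · intro h
    by_cases htop : P.primalPart G W ψ' < ⊤
    · obtain ⟨hd, hQ⟩ := P.primalPart_lt_top_iff.1 htop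
      rw [P.primalPart_eq hd hQ, WithTop.coe_le_coe]
      linarith [h hd hQ]
    · rw [not_lt_top_iff.1 htop]; exact le_top

end AggProblem

namespace AggProblem

variable {N l : ℕ} (P : AggProblem N l) {G : SimpleGraph (Fin N)}

lemma mulVec_add_aggregate (x : P.Decision) (i : Fin N) :
    P.A i *ᵥ x i + P.aggregate i x = ∑ j, P.A j *ᵥ x j :=
  Finset.add_sum_erase _ (fun j => P.A j *ᵥ x j) (Finset.mem_univ i)

/-- The consistent network state with decisions `x`, auxiliary variables `y` and multipliers
`lam`, `mu`. -/
def consistentState (x : P.Decision) (y : Fin N → Fin l → ℝ) (lam mu : G.Dart → Fin l → ℝ) :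
    P.Stack G :=
  (x, fun i => P.aggregate i x, lam, y, mu, fun e => y e.fst)

@[simp] lemma gap_consistentState (x : P.Decision) (y : Fin N → Fin l → ℝ)
    (lam mu : G.Dart → Fin l → ℝ) (e : G.Dart) :
    P.gap (P.consistentState x y lam mu) e = 0 := by
  simp only [gap, consistentState, Stack.x, Stack.sig, mulVec_add_aggregate, sub_self]

@[simp] lemma estErr_consistentState (x : P.Decision) (y : Fin N → Fin l → ℝ)
    (lam mu : G.Dart → Fin l → ℝ) (e : G.Dart) :
    P.estErr (P.consistentState x y lam mu) e = 0 := by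
  simp [estErr, consistentState, Stack.y, Stack.est]

variable [DecidableRel G.Adj] {W : Matrix (Fin N) (Fin N) ℝ}

/-- Every `x` extends to a consistent state satisfying all equations `F_i`. -/
lemma exists_consistentState_mem_setF (hG : G.Connected) (hW : IsWeightMatrix G W)
    (x : P.Decision) :
    ∃ y, ∀ (lam mu : G.Dart → Fin l → ℝ) (i : Fin N),
      P.consistentState x y lam mu ∈ P.setF G W i := by
  have hsum : ∑ i, (((N : ℝ) - 1) • (P.A i *ᵥ x i) - P.aggregate i x) = 0 := by
    have h : ∀ i, ((N : ℝ) - 1) • (P.A i *ᵥ x i) - P.aggregate i x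
        = (N : ℝ) • (P.A i *ᵥ x i) - ∑ j, P.A j *ᵥ x j := by
      intro i
      rw [← P.mulVec_add_aggregate x i]
      module
    simp only [h, Finset.sum_sub_distrib, ← Finset.smul_sum, Finset.sum_const, Finset.card_univ,
      Fintype.card_fin]
    rw [Nat.cast_smul_eq_nsmul, sub_self]
  obtain ⟨y, hy⟩ := hW.exists_diag_add_sum_darts_eq hG hsum
  exact ⟨y, fun lam mu i => (hy i).symm⟩

/-- A state without disagreement that satisfies the equations `F_i` has `σ_i = s_i(x_{-i})`. -/
lemma sig_eq_aggregate (hG : G.Connected) (hW : IsWeightMatrix G W) {ψ : P.Stack G}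
    (hF : ∀ i, ψ ∈ P.setF G W i) (hgap : ∀ e, P.gap ψ e = 0) (herr : ∀ e, P.estErr ψ e = 0)
    (i : Fin N) : ψ.sig i = P.aggregate i ψ.x := by
  have hconst : ∀ j, P.A j *ᵥ ψ.x j + ψ.sig j = P.A i *ᵥ ψ.x i + ψ.sig i := fun j =>
    hG.eq_of_forall_adj (t := fun j => P.A j *ᵥ ψ.x j + ψ.sig j)
      (fun a b hab => (sub_eq_zero.1 (hgap ⟨(a, b), hab⟩)).symm) j i
  have hF' : ∀ j, ((N : ℝ) - 1) • (P.A j *ᵥ ψ.x j) - ψ.sig j = ∑ k, W k j • ψ.y k := by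
    intro j
    have h : _ = _ := hF j
    rw [h, ← hW.diag_add_sum_darts]
    congr 1
    refine Finset.sum_congr rfl fun e _ => ?_
    rw [sub_eq_zero.1 (herr e)]
  have hsum : ∑ j, (((N : ℝ) - 1) • (P.A j *ᵥ ψ.x j) - ψ.sig j) = 0 := by
    simp_rw [hF']
    rw [Finset.sum_comm]
    simp [← Finset.sum_smul, hW.sum_row]
  have hterm : ∀ j, ((N : ℝ) - 1) • (P.A j *ᵥ ψ.x j) - ψ.sig j
      = (N : ℝ) • (P.A j *ᵥ ψ.x j) - (P.A i *ᵥ ψ.x i + ψ.sig i) := by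
    intro j
    rw [← hconst j]
    module
  simp only [hterm, Finset.sum_sub_distrib, ← Finset.smul_sum, Finset.sum_const,
    Finset.card_univ, Fintype.card_fin] at hsum
  rw [← Nat.cast_smul_eq_nsmul ℝ, ← smul_sub] at hsum
  have hN : (N : ℝ) ≠ 0 := Nat.cast_ne_zero.2 (Fin.pos i).ne'
  have h := sub_eq_zero.1 ((smul_eq_zero.1 hsum).resolve_left hN)
  rw [← P.mulVec_add_aggregate ψ.x i] at h
  exact (add_left_cancel h).symm

lemma objective_eq_coe {x : P.Decision}
    (h : ∀ i, P.J i (x i, P.aggregate i x) < ⊤) :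
    P.objective x = ((∑ i, P.objReal i (x i, P.aggregate i x) : ℝ) : WithTop ℝ) := by
  rw [objective, WithTop.coe_sum]
  exact Finset.sum_congr rfl fun i _ => (P.coe_objReal (h i)).symm

lemma objective_lt_top_iff {x : P.Decision} :
    P.objective x < ⊤ ↔ ∀ i, P.J i (x i, P.aggregate i x) < ⊤ := by
  simp [objective, WithTop.sum_lt_top]

lemma consistentState_mem_netDomain {x : P.Decision} {y : Fin N → Fin l → ℝ}
    {lam mu : G.Dart → Fin l → ℝ} (hX : ∀ i, x i ∈ P.X i)
    (hJ : ∀ i, P.J i (x i, P.aggregate i x) < ⊤)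
    (hy : ∀ i, P.consistentState x y lam mu ∈ P.setF G W i) :
    P.consistentState x y lam mu ∈ P.netDomain W :=
  fun i => ⟨⟨⟨hX i, Set.mem_univ _⟩, hJ i⟩, hy i⟩

/-- Zeros of the operator are consistent. -/
lemma gap_estErr_eq_zero_of_mem_zerT {ψ : P.Stack G} (hψ : ψ ∈ P.zerT G W) :
    (∀ e, P.gap ψ e = 0) ∧ ∀ e, P.estErr ψ e = 0 := by
  obtain ⟨⟨hd, hQ⟩, hmin⟩ := P.mem_zerT_iff.1 hψ
  let φ : P.Stack G := (0, 0, P.gap ψ, 0, P.estErr ψ, 0)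
  have hx : Stack.x (ψ + φ) = ψ.x := add_zero _
  have hσ : Stack.sig (ψ + φ) = ψ.sig := add_zero _
  have hy : Stack.y (ψ + φ) = ψ.y := add_zero _
  have he : Stack.est (ψ + φ) = ψ.est := add_zero _
  have h := hmin (ψ + φ) (fun i => by
      refine ⟨by rw [hx, hσ]; exact (hd i).1, ?_⟩
      rw [mem_setF_iff, residual, hx, hσ, hy, he]
      exact P.mem_setF_iff.1 (hd i).2) (by rw [hx, hσ]; exact hQ)
  have hval : P.netObjReal (ψ + φ) = P.netObjReal ψ := by
    rw [netObjReal, hx, hσ, netObjReal]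
  have hg : ∀ e, P.gap φ e = 0 := fun e => by simp [gap, φ, Stack.x, Stack.sig]
  have hr : ∀ e, P.estErr φ e = 0 := fun e => by simp [estErr, φ, Stack.y, Stack.est]
  rw [hval, add_sub_cancel_left, stackInner_skewPart] at h
  simp only [hg, hr, dotProduct_zero, Finset.sum_const_zero] at h
  change _ ≤ _ + (0 + 0 - ∑ e, P.gap ψ e ⬝ᵥ P.gap ψ e - ∑ e, P.estErr ψ e ⬝ᵥ P.estErr ψ e) at h
  have n1 : ∀ e ∈ Finset.univ, 0 ≤ P.gap ψ e ⬝ᵥ P.gap ψ e := fun e _ =>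
    Finset.sum_nonneg fun k _ => mul_self_nonneg _
  have n2 : ∀ e ∈ Finset.univ, 0 ≤ P.estErr ψ e ⬝ᵥ P.estErr ψ e := fun e _ =>
    Finset.sum_nonneg fun k _ => mul_self_nonneg _
  have s1 := Finset.sum_nonneg n1
  have s2 := Finset.sum_nonneg n2
  have z1 := (Finset.sum_eq_zero_iff_of_nonneg n1).1 (by linarith)
  have z2 := (Finset.sum_eq_zero_iff_of_nonneg n2).1 (by linarith)
  exact ⟨fun e => dotProduct_self_eq_zero.1 (z1 e (Finset.mem_univ e)),
    fun e => dotProduct_self_eq_zero.1 (z2 e (Finset.mem_univ e))⟩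

theorem isMinimizer_of_mem_zerT (hG : G.Connected) (hW : IsWeightMatrix G W) {ψ : P.Stack G}
    (hψ : ψ ∈ P.zerT G W) : P.IsMinimizer ψ.x := by
  obtain ⟨hgap, herr⟩ := P.gap_estErr_eq_zero_of_mem_zerT hψ
  obtain ⟨⟨hd, hQ⟩, hmin⟩ := P.mem_zerT_iff.1 hψ
  have hσ := P.sig_eq_aggregate hG hW (fun i => (hd i).2) hgap herr
  have hfin : ∀ i, P.J i (ψ.x i, P.aggregate i ψ.x) < ⊤ := fun i => by
    rw [← hσ i]; exact (hd i).1.2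
  obtain ⟨i₀⟩ := hG.nonempty
  refine ⟨⟨fun i => (hd i).1.1.1, ?_⟩, P.objective_lt_top_iff.2 hfin, fun x' hx' => ?_⟩
  · rw [← P.mulVec_add_aggregate ψ.x i₀, ← hσ i₀]; exact hQ i₀
  by_cases htop : P.objective x' < ⊤
  swap
  · rw [not_lt_top_iff.1 htop]; exact le_top
  have hfin' := P.objective_lt_top_iff.1 htop
  obtain ⟨y, hy⟩ := P.exists_consistentState_mem_setF hG hW x'
  have h := hmin (P.consistentState x' y ψ.lam ψ.mu)
    (P.consistentState_mem_netDomain hx'.1 hfin' (hy _ _))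
    (fun i => by
      change P.A i *ᵥ x' i + P.aggregate i x' ≤ P.c
      rw [P.mulVec_add_aggregate]; exact hx'.2)
  rw [stackInner_skewPart] at h
  simp only [gap_sub, estErr_sub, gap_consistentState, estErr_consistentState, hgap, herr,
    sub_zero, dotProduct_zero, zero_dotProduct, Finset.sum_const_zero, add_zero] at h
  rw [P.objective_eq_coe hfin, P.objective_eq_coe hfin', WithTop.coe_le_coe]
  have e : P.netObjReal ψ = ∑ i, P.objReal i (ψ.x i, P.aggregate i ψ.x) :=
    Finset.sum_congr rfl fun i _ => by rw [hσ i]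
  rw [← e]
  exact h

lemma convexOn_netObjReal (hJ : ∀ i, IsCCPOn (P.objDomain i) (P.J i)) :
    ConvexOn ℝ (P.netDomain (G := G) W) P.netObjReal := by
  refine ⟨fun ψ hψ φ hφ a b ha hb hab i => ?_, fun ψ hψ φ hφ a b ha hb hab => ?_⟩
  · exact ⟨(P.convexOn_objReal (hJ i)).1 (hψ i).1 (hφ i).1 ha hb hab,
      P.combo_mem_setF (hψ i).2 (hφ i).2 a b⟩
  · simp only [netObjReal, Finset.smul_sum]
    rw [← Finset.sum_add_distrib]
    exact Finset.sum_le_sum fun i _ =>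
      (P.convexOn_objReal (hJ i)).2 (hψ i).1 (hφ i).1 ha hb hab

lemma isRelIntPoint_netDomain (hJ : ∀ i, IsCCPOn (P.objDomain i) (P.J i)) {ψ : P.Stack G}
    (h : ∀ i, IsRelIntPoint (effDomOn (P.objDomain i) (P.J i)) (ψ.x i, ψ.sig i))
    (hF : ∀ i, ψ ∈ P.setF G W i) : IsRelIntPoint (P.netDomain W) ψ := by
  refine ⟨fun i => ⟨(h i).1, hF i⟩, fun φ hφ => ?_⟩
  choose ε hε hmem using fun i =>
    (h i).exists_forall_le (P.convexOn_objReal (hJ i)).1 (hφ i).1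
  obtain ⟨δ, hδ, hle⟩ : ∃ δ : ℝ, 0 < δ ∧ ∀ i, δ ≤ ε i := by
    rcases isEmpty_or_nonempty (Fin N) with hE | hne
    · exact ⟨1, one_pos, fun i => hE.elim i⟩
    · obtain ⟨m, hm⟩ := Finite.exists_min ε
      exact ⟨ε m, hε m, hm⟩
  refine ⟨δ, hδ, fun i => ⟨hmem i δ hδ.le (hle i), ?_⟩⟩
  rw [show ψ + δ • (ψ - φ) = (1 + δ) • ψ + (-δ) • φ by module]
  exact P.combo_mem_setF (hF i) (hφ i).2 _ _

theorem exists_mem_zerT_of_isMinimizer (hJ : ∀ i, IsCCPOn (P.objDomain i) (P.J i))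
    (hG : G.Connected) (hW : IsWeightMatrix G W) (hdom : P.DomainQualified) {x : P.Decision}
    (hx : P.IsMinimizer x) :
    ∃ y lam mu, P.consistentState x y lam mu ∈ P.zerT G W := by
  obtain ⟨⟨hxX, hxc⟩, hxtop, hxmin⟩ := hx
  obtain ⟨xh, ⟨_, hxhc⟩, hri⟩ := hdom
  have hfin := P.objective_lt_top_iff.1 hxtop
  obtain ⟨y, hy⟩ := P.exists_consistentState_mem_setF hG hW x
  obtain ⟨yh, hyh⟩ := P.exists_consistentState_mem_setF hG hW xh
  set m : ℝ := ∑ i, P.objReal i (x i, P.aggregate i x) with hm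
  let g : Fin N × Fin l → P.Stack G → ℝ := fun k ψ =>
    (P.A k.1 *ᵥ ψ.x k.1 + ψ.sig k.1) k.2 - P.c k.2
  let h : (G.Dart × Fin l) ⊕ (G.Dart × Fin l) → P.Stack G → ℝ :=
    Sum.elim (fun k ψ => P.gap ψ k.1 k.2) (fun k ψ => P.estErr ψ k.1 k.2)
  have hg : ∀ k, IsAffineFun (g k) := by
    intro k ψ φ a b hab
    simp only [g, Stack.x, Stack.sig, Prod.fst_add, Prod.snd_add, Prod.smul_fst, Prod.smul_snd,
      Pi.add_apply, Pi.smul_apply, Matrix.mulVec_add, Matrix.mulVec_smul, smul_eq_mul]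
    linear_combination P.c k.2 * hab
  have hh : ∀ k, IsAffineFun (h k) := by
    rintro (k | k) ψ φ a b -
    · simp [h, gap_combo]
    · simp [h, estErr_combo]
  have hconv : ConvexOn ℝ (P.netDomain (G := G) W) (fun ψ => P.netObjReal ψ + -m) :=
    (P.convexOn_netObjReal hJ).add_const (-m)
  have hrel : IsRelIntPoint (P.netDomain W) (P.consistentState xh yh (0 : G.Dart → Fin l → ℝ) 0) :=
    P.isRelIntPoint_netDomain hJ (fun i => .of_mem_intrinsicInterior (hri i)) (hyh _ _)
  have hQ : ∀ {ψ : P.Stack G}, (∀ k, g k ψ ≤ 0) ↔ ∀ i, P.A i *ᵥ ψ.x i + ψ.sig i ≤ P.c := by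
    intro ψ
    constructor
    · exact fun H i k => sub_nonpos.1 (H (i, k))
    · exact fun H k => sub_nonpos.2 (H k.1 k.2)
  obtain ⟨ν, hν⟩ := exists_multipliers_of_affine_eq hg hh hconv hrel
    (hQ.2 fun i => (P.mulVec_add_aggregate xh i).trans_le hxhc)
    (by rintro (k | k) <;> simp [h])
    (by
      intro ψ hψ hgψ hhψ
      have hσ := P.sig_eq_aggregate hG hW (fun i => (hψ i).2)
        (fun e => funext fun k => hhψ (Sum.inl (e, k)))
        (fun e => funext fun k => hhψ (Sum.inr (e, k)))
      have hfin' : ∀ i, P.J i (ψ.x i, P.aggregate i ψ.x) < ⊤ := fun i => by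
        rw [← hσ i]; exact (hψ i).1.2
      obtain ⟨i₀⟩ := hG.nonempty
      have hle := hxmin ψ.x ⟨fun i => (hψ i).1.1.1, by
        rw [← P.mulVec_add_aggregate ψ.x i₀, ← hσ i₀]; exact hQ.1 hgψ i₀⟩
      rw [P.objective_eq_coe hfin, P.objective_eq_coe hfin', WithTop.coe_le_coe] at hle
      have e : P.netObjReal ψ = ∑ i, P.objReal i (ψ.x i, P.aggregate i ψ.x) :=
        Finset.sum_congr rfl fun i _ => by rw [hσ i]
      rw [e]
      linarith)
  refine ⟨y, fun e k => ν (Sum.inl (e, k)), fun e k => ν (Sum.inr (e, k)),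
    P.mem_zerT_iff.2 ⟨⟨P.consistentState_mem_netDomain hxX hfin (hy _ _), fun i =>
      (P.mulVec_add_aggregate x i).trans_le hxc⟩, fun ψ' hψ' hQ' => ?_⟩⟩
  have key := hν ψ' hψ' (hQ.2 hQ')
  rw [Fintype.sum_sum_type, Fintype.sum_prod_type, Fintype.sum_prod_type] at key
  rw [stackInner_skewPart]
  simp only [gap_sub, estErr_sub, gap_consistentState, estErr_consistentState, sub_zero,
    zero_dotProduct, Finset.sum_const_zero]
  change m ≤ P.netObjReal ψ' + (∑ e, ∑ k, ν (Sum.inl (e, k)) * P.gap ψ' e k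
    + ∑ e, ∑ k, ν (Sum.inr (e, k)) * P.estErr ψ' e k)
  change 0 ≤ P.netObjReal ψ' + -m + (∑ e, ∑ k, ν (Sum.inl (e, k)) * P.gap ψ' e k
    + ∑ e, ∑ k, ν (Sum.inr (e, k)) * P.estErr ψ' e k) at key
  linarith

end AggProblem

end

theorem theorem1 {N l : ℕ} (P : AggProblem N l)
    (G : SimpleGraph (Fin N)) [DecidableRel G.Adj] (W : Matrix (Fin N) (Fin N) ℝ)
    (hJ : ∀ i, IsCCPOn (P.objDomain i) (P.J i))
    (hX : ∀ i, (P.X i).Nonempty ∧ IsClosed (P.X i) ∧ Convex ℝ (P.X i))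
    (hSlater : P.Slater)
    (hG : G.Connected) (hout : ∀ i, ∃ j, G.Adj i j)
    (hW : IsWeightMatrix G W) :
    (∀ ψ ∈ P.zerT G W, P.IsMinimizer ψ.x) ∧
    (P.DomainQualified → ∀ x : P.Decision, P.IsMinimizer x →
      ∃ (σ : Fin N → Fin l → ℝ) (lam : G.Dart → Fin l → ℝ) (ω : P.Omega G),
        (x, σ, lam, ω) ∈ P.zerT G W) := by
  refine ⟨fun ψ hψ => P.isMinimizer_of_mem_zerT hG hW hψ, fun hdom x hx => ?_⟩
  obtain ⟨y, lam, mu, h⟩ := P.exists_mem_zerT_of_isMinimizer hJ hG hW hdom hx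
  exact ⟨_, _, _, h⟩
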